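/- Let $L$ be an orthomodular lattice with least element $\bot$, greatest element $\top$ and orthocomplement $p \mapsto p^\bot$, and let $p \mathbin{\&} q = q \wedge (p \vee q^\bot)$ denote the Sasaki projection. Consider the first-order language with one binary relation symbol $\mathrm{Mes}(\cdot, p, \cdot)$ for each $p \in L$, and write $s \Vdash p$ ("$s$ verifies $p$") for the formula $\neg \exists t\, \mathrm{Mes}(s, p^\bot, t)$. Let $\mathcal T_L$ be the theory with the axioms 1. $\forall s\; s \Vdash \top$; 2. $\forall s\; \neg (s \Vdash \bot)$; 3. $\exists s\; \neg (s \Vdash p)$, for each $p \in L$ with $p \neq \top$; 4. $\forall s\; (s \Vdash p \Rightarrow s \Vdash q)$, for all $p, q \in L$ with $p \le q$; 5. $\forall s\; (s \Vdash p \text{ and } s \Vdash q \Rightarrow s \Vdash p \mathbin{\&} q)$, for all $p, q \in L$; 6. $\forall s\, \forall t\; (s \Vdash p \text{ and } \mathrm{Mes}(s, q, t) \Rightarrow t \Vdash p \mathbin{\&} q)$, for all $p, q \in L$. A model of $\mathcal T_L$ is a set $A$ with a relation $M \subseteq A \times L \times A$ in which all these axioms hold when $\mathrm{Mes}(\cdot,p,\cdot)$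 is interpreted as $M(\cdot,p,\cdot)$. For $a \in A$, let $[\![a]\!] = \{p \in L : \text{there is no } b \in A \text{ with } M(a, p^\bot, b)\}$ be the set of properties verified by $a$. Let $\mathcal H$ be a real or complex Hilbert space with $3 \le \dim \mathcal H < \infty$, and let $L(\mathcal H)$ be the orthomodular lattice of closed subspaces of $\mathcal H$, ordered by inclusion, with the orthogonal complement. If $(A, M)$ is a model of $\mathcal T_{L(\mathcal H)}$, then for every $a \in A$ the set $[\![a]\!]$ contains at most one minimal element (minimal with respect to inclusion). -/

import Mathlib

universe u v w

/-- An orthomodular lattice: a bounded lattice with an orthocomplementation `ᶜ`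
(an order-reversing involution that is a lattice complement) satisfying the orthomodular law. -/
class OrthomodularLattice (L : Type u) [Lattice L] [BoundedOrder L] extends Compl L where
  compl_compl' : ∀ p : L, pᶜᶜ = p
  compl_anti : ∀ {p q : L}, p ≤ q → qᶜ ≤ pᶜ
  inf_compl : ∀ p : L, p ⊓ pᶜ = ⊥
  sup_compl : ∀ p : L, p ⊔ pᶜ = ⊤
  orthomodular : ∀ {p q : L}, p ≤ q → q = p ⊔ (q ⊓ pᶜ)

/-- The Hilbert lattice `L(H)`: the closed subspaces of a Hilbert space, ordered by inclusion,
form an orthomodular lattice with the orthogonal complement. -/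
noncomputable instance hilbertLattice (𝕜 : Type u) (H : Type v) [RCLike 𝕜]
    [NormedAddCommGroup H] [InnerProductSpace 𝕜 H] [CompleteSpace H] :
    OrthomodularLattice (ClosedSubmodule 𝕜 H) where
  compl p := p.orthogonal
  compl_compl' p := by
    apply ClosedSubmodule.toSubmodule_injective
    have : CompleteSpace p.toSubmodule := p.isClosed.completeSpace_coe
    exact Submodule.orthogonal_orthogonal p.toSubmodule
  compl_anti h := ClosedSubmodule.orthogonal_le h
  inf_compl p := ClosedSubmodule.toSubmodule_injective
    (Submodule.inf_orthogonal_eq_bot p.toSubmodule)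
  sup_compl p := by
    have : CompleteSpace p.toSubmodule := p.isClosed.completeSpace_coe
    refine top_le_iff.mp fun x _ => ?_
    rw [← add_sub_cancel (p.toSubmodule.starProjection x) x]
    refine add_mem ((le_sup_left : p ≤ p ⊔ p.orthogonal)
      (p.toSubmodule.starProjection_apply_mem x)) ?_
    exact (le_sup_right : p.orthogonal ≤ p ⊔ p.orthogonal)
      (p.toSubmodule.sub_starProjection_mem_orthogonal x)
  orthomodular {p q} h := by
    have : CompleteSpace p.toSubmodule := p.isClosed.completeSpace_coe
    refine le_antisymm (fun x hx => ?_) (sup_le h inf_le_left)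
    have h1 : p.toSubmodule.starProjection x ∈ p := p.toSubmodule.starProjection_apply_mem x
    have h2 : x - p.toSubmodule.starProjection x ∈ q ⊓ p.orthogonal :=
      ⟨q.toSubmodule.sub_mem hx (h h1),
        p.toSubmodule.sub_starProjection_mem_orthogonal x⟩
    rw [← add_sub_cancel (p.toSubmodule.starProjection x) x]
    exact add_mem ((le_sup_left : p ≤ p ⊔ (q ⊓ p.orthogonal)) h1)
      ((le_sup_right : q ⊓ p.orthogonal ≤ p ⊔ (q ⊓ p.orthogonal)) h2)

namespace MeasurementLogic

/-- The Sasaki projection `p & q = q ∧ (p ∨ qᗮ)`. -/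
def sasaki {L : Type u} [Lattice L] [BoundedOrder L] [OrthomodularLattice L] (p q : L) : L :=
  q ⊓ (p ⊔ qᶜ)

/-- The relation symbols: for each `p : L` a binary symbol `Mes(·, p, ·)`. -/
inductive MesSymbol (L : Type u) : ℕ → Type u
  | mes (p : L) : MesSymbol L 2

/-- The first-order language whose only symbols are the `Mes(·, p, ·)`, `p : L`. -/
def mesLanguage (L : Type u) : FirstOrder.Language.{0, u} :=
  ⟨fun _ => Empty, MesSymbol L⟩

section Theory

variable {L : Type u}

/-- The atomic formula `Mes(s, p, t)`, where `s` and `t` are two of `n` variables. -/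
def mesFormula {n : ℕ} (s : Fin n) (p : L) (t : Fin n) : (mesLanguage L).BoundedFormula Empty n :=
  FirstOrder.Language.Relations.boundedFormula₂ (L := mesLanguage L) (MesSymbol.mes p)
    (FirstOrder.Language.Term.var (Sum.inr s)) (FirstOrder.Language.Term.var (Sum.inr t))

variable [Lattice L] [BoundedOrder L] [OrthomodularLattice L]

/-- The verification statement "`s` verifies `p`": the formula `¬ ∃ t, Mes(s, pᗮ, t)`. -/
def verifiesFormula {n : ℕ} (s : Fin n) (p : L) : (mesLanguage L).BoundedFormula Empty n :=
  (mesFormula s.castSucc pᶜ (Fin.last n)).ex.not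

variable (L)

/-- The axioms of the theory `T_L`; the variable of a one-variable sentence is `0`, and in the
last axiom scheme `s` is `0` and `t` is `1`. -/
inductive IsAxiom : (mesLanguage L).Sentence → Prop
  /-- `∀ s, s` verifies `⊤`. -/
  | verifies_top : IsAxiom (verifiesFormula (n := 1) 0 (⊤ : L)).all
  /-- `∀ s, ¬ (s` verifies `⊥)`. -/
  | not_verifies_bot : IsAxiom (verifiesFormula (n := 1) 0 (⊥ : L)).not.all
  /-- For all `p ≠ ⊤`: `∃ s, ¬ (s` verifies `p)`. -/
  | is_outcome (p : L) (hp : p ≠ ⊤) : IsAxiom (verifiesFormula (n := 1) 0 p).not.ex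
  /-- For all `p ≤ q`: `∀ s, s` verifies `p → s` verifies `q`. -/
  | upper (p q : L) (hpq : p ≤ q) :
      IsAxiom ((verifiesFormula (n := 1) 0 p).imp (verifiesFormula 0 q)).all
  /-- For all `p, q`: `∀ s, s` verifies `p` and `s` verifies `q → s` verifies `p & q`. -/
  | sasaki_stable (p q : L) :
      IsAxiom ((verifiesFormula (n := 1) 0 p ⊓ verifiesFormula 0 q).imp
        (verifiesFormula 0 (sasaki p q))).all
  /-- For all `p, q`: `∀ s t, s` verifies `p` and `Mes(s, q, t) → t` verifies `p & q`. -/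
  | preservation (p q : L) :
      IsAxiom ((verifiesFormula (n := 2) 0 p ⊓ mesFormula 0 q 1).imp
        (verifiesFormula 1 (sasaki p q))).all.all

/-- The theory `T_L`, as a set of first-order sentences. -/
def measurementTheory : (mesLanguage L).Theory := {φ | IsAxiom L φ}

end Theory

/-- A graph `(A, M)` with arrows labelled by `L`, i.e. a relation `M ⊆ A × L × A`, seen as a
first-order structure: `Mes(·, p, ·)` is interpreted as `M · p ·`. -/
@[reducible] def graphStructure {L : Type u} {A : Type v} (M : A → L → A → Prop) :
    (mesLanguage L).Structure A where
  funMap f := f.elim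
  RelMap r := match r with
    | MesSymbol.mes p => fun x => M (x 0) p (x 1)

theorem realize_mesFormula {L : Type u} {A : Type v} (M : A → L → A → Prop) {n : ℕ} (s : Fin n) (p : L) (t : Fin n)
    (e : Empty → A) (x : Fin n → A) :
    @FirstOrder.Language.BoundedFormula.Realize (mesLanguage L) A (graphStructure M) _ _ (mesFormula s p t) e x ↔
      M (x s) p (x t) := by
  let _ := graphStructure M
  exact FirstOrder.Language.BoundedFormula.realize_rel₂

section Models

variable {L : Type u} [Lattice L] [BoundedOrder L] [OrthomodularLattice L] {A : Type v}

/-- The graph `(A, M)` is a model of `T_L`: every axiom of `T_L` holds in it. -/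
def IsModel (M : A → L → A → Prop) : Prop :=
  @FirstOrder.Language.Theory.Model (mesLanguage L) A (graphStructure M) (measurementTheory L)

/-- `a` verifies `p` in the graph `(A, M)`: there is no arrow labelled `pᗮ` starting from `a`. -/
def Verifies (M : A → L → A → Prop) (a : A) (p : L) : Prop :=
  ¬ ∃ t, M a pᶜ t

/-- The set `⟦a⟧` of all properties verified by `a` in the graph `(A, M)`. -/
def verified (M : A → L → A → Prop) (a : A) : Set L :=
  {p | Verifies M a p}

theorem realize_verifiesFormula (M : A → L → A → Prop) {n : ℕ} (s : Fin n) (p : L)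
    (e : Empty → A) (x : Fin n → A) :
    @FirstOrder.Language.BoundedFormula.Realize (mesLanguage L) A (graphStructure M) _ _ (verifiesFormula s p) e x ↔
      Verifies M (x s) p := by
  let _ := graphStructure M
  simp [verifiesFormula, Verifies, realize_mesFormula]

/-- Being a model of `T_L`, spelled out in terms of the graph `(A, M)`. -/
theorem isModel_iff (M : A → L → A → Prop) :
    IsModel M ↔
      (∀ a, Verifies M a ⊤) ∧
      (∀ a, ¬ Verifies M a ⊥) ∧
      (∀ p : L, p ≠ ⊤ → ∃ a, ¬ Verifies M a p) ∧
      (∀ p q : L, p ≤ q → ∀ a, Verifies M a p → Verifies M a q) ∧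
      (∀ p q : L, ∀ a, Verifies M a p ∧ Verifies M a q → Verifies M a (sasaki p q)) ∧
      (∀ p q : L, ∀ a b, Verifies M a p ∧ M a q b → Verifies M b (sasaki p q)) := by
  let _ := graphStructure M
  have key : IsModel M ↔ ∀ φ, IsAxiom L φ → @FirstOrder.Language.Sentence.Realize (mesLanguage L) A (graphStructure M) φ := FirstOrder.Language.Theory.model_iff _
  rw [key]
  constructor
  · intro h
    refine ⟨?_, ?_, fun p hp => ?_, fun p q hpq => ?_, fun p q => ?_, fun p q => ?_⟩
    · simpa [FirstOrder.Language.Sentence.Realize, FirstOrder.Language.Formula.Realize, realize_verifiesFormula,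
        Fin.snoc] using h _ .verifies_top
    · simpa [FirstOrder.Language.Sentence.Realize, FirstOrder.Language.Formula.Realize, realize_verifiesFormula,
        Fin.snoc] using h _ .not_verifies_bot
    · simpa [FirstOrder.Language.Sentence.Realize, FirstOrder.Language.Formula.Realize, realize_verifiesFormula,
        Fin.snoc] using h _ (.is_outcome p hp)
    · simpa [FirstOrder.Language.Sentence.Realize, FirstOrder.Language.Formula.Realize, realize_verifiesFormula,
        Fin.snoc] using h _ (.upper p q hpq)
    · simpa [FirstOrder.Language.Sentence.Realize, FirstOrder.Language.Formula.Realize, realize_verifiesFormula,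
        Fin.snoc] using h _ (.sasaki_stable p q)
    · simpa [FirstOrder.Language.Sentence.Realize, FirstOrder.Language.Formula.Realize, realize_verifiesFormula,
        realize_mesFormula, Fin.snoc] using h _ (.preservation p q)
  · rintro ⟨h1, h2, h3, h4, h5, h6⟩ φ hφ
    cases hφ with
    | verifies_top =>
      simpa [FirstOrder.Language.Sentence.Realize, FirstOrder.Language.Formula.Realize, realize_verifiesFormula,
        Fin.snoc] using h1
    | not_verifies_bot =>
      simpa [FirstOrder.Language.Sentence.Realize, FirstOrder.Language.Formula.Realize, realize_verifiesFormula,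
        Fin.snoc] using h2
    | is_outcome p hp =>
      simpa [FirstOrder.Language.Sentence.Realize, FirstOrder.Language.Formula.Realize, realize_verifiesFormula,
        Fin.snoc] using h3 p hp
    | upper p q hpq =>
      simpa [FirstOrder.Language.Sentence.Realize, FirstOrder.Language.Formula.Realize, realize_verifiesFormula,
        Fin.snoc] using h4 p q hpq
    | sasaki_stable p q =>
      simpa [FirstOrder.Language.Sentence.Realize, FirstOrder.Language.Formula.Realize, realize_verifiesFormula,
        Fin.snoc] using h5 p q
    | preservation p q =>
      simpa [FirstOrder.Language.Sentence.Realize, FirstOrder.Language.Formula.Realize, realize_verifiesFormula,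
        realize_mesFormula, Fin.snoc] using h6 p q

end Models

end MeasurementLogic

/-! The heart of the matter is that one state verifies at most one line. Two verified lines are
never orthogonal, since their Sasaki projection would be `⊥`. If the line of `w` is not verified,
then measuring its orthocomplement is possible, and the outcome verifies the projections of the
verified lines, which again cannot be orthogonal. These two facts are abstracted in
`IsNonorthogonalFamily`. In dimension at least three they turn two distinct lines into a whole cone
of verified lines, containing pairs at a larger angle; iterating produces an orthogonal pair
(`false_of_tan_sq`).

Distinct minimal `P` and `Q` are reduced to this case by a single measurement. It collapses `P` to
the line of some `x` in `P` orthogonal to `P ⊓ Q`, and `Q` to the span of a single vector. As these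
lines must agree, some vector of `P ⊓ Q` fails to be orthogonal to `x`, a contradiction. -/

open scoped InnerProductSpace

/-! ### Geometry: enlarging the angle between two lines -/

section NonorthogonalFamilies

variable {𝕜 : Type u} {H : Type v} [RCLike 𝕜] [NormedAddCommGroup H] [InnerProductSpace 𝕜 H]

/-- In dimension at least three, any two vectors have a common orthogonal vector of any given
norm. -/
theorem exists_orthogonal_pair_norm_eq [FiniteDimensional 𝕜 H] (hdim : 3 ≤ Module.finrank 𝕜 H)
    (x y : H) {r : ℝ} (hr : 0 ≤ r) : ∃ z : H, ⟪x, z⟫_𝕜 = 0 ∧ ⟪y, z⟫_𝕜 = 0 ∧ ‖z‖ = r := by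
  classical
  have hle : Module.finrank 𝕜 (Submodule.span 𝕜 ({x, y} : Set H)) ≤ 2 := by
    have h := finrank_span_finset_le_card (R := 𝕜) ({x, y} : Finset H)
    rw [Finset.coe_pair] at h
    exact h.trans Finset.card_le_two
  have hadd := (Submodule.span 𝕜 ({x, y} : Set H)).finrank_add_finrank_orthogonal
  have hne : (Submodule.span 𝕜 ({x, y} : Set H))ᗮ ≠ ⊥ := by
    intro h
    rw [h, finrank_bot] at hadd
    omega
  obtain ⟨z, hz, hz0⟩ := Submodule.exists_mem_ne_zero_of_ne_bot hne
  rw [Submodule.mem_orthogonal] at hz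
  have hx := hz x (Submodule.subset_span (by simp))
  have hy := hz y (Submodule.subset_span (by simp))
  refine ⟨((r / ‖z‖ : ℝ) : 𝕜) • z, by simp [inner_smul_right, hx],
    by simp [inner_smul_right, hy], ?_⟩
  rw [norm_smul, RCLike.norm_ofReal, abs_of_nonneg (by positivity),
    div_mul_cancel₀ _ (norm_ne_zero_iff.mpr hz0)]

/-- The inner product of two vectors given in real coordinates with respect to an orthogonal
triple. -/
theorem inner_real_combination {x y z : H} (hxy : ⟪x, y⟫_𝕜 = 0) (hxz : ⟪x, z⟫_𝕜 = 0)
    (hyz : ⟪y, z⟫_𝕜 = 0) (a b c a' b' c' : ℝ) :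
    ⟪(a : 𝕜) • x + (b : 𝕜) • y + (c : 𝕜) • z, (a' : 𝕜) • x + (b' : 𝕜) • y + (c' : 𝕜) • z⟫_𝕜 =
      ((a * a' * ‖x‖ ^ 2 + b * b' * ‖y‖ ^ 2 + c * c' * ‖z‖ ^ 2 : ℝ) : 𝕜) := by
  have hyx := inner_eq_zero_symm.mp hxy
  have hzx := inner_eq_zero_symm.mp hxz
  have hzy := inner_eq_zero_symm.mp hyz
  simp only [inner_add_left, inner_add_right, inner_smul_left, inner_smul_right, hxy, hxz, hyz,
    hyx, hzx, hzy, inner_self_eq_norm_sq_to_K, RCLike.conj_ofReal]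
  push_cast
  ring

/-- A set of vectors without orthogonal pairs, such that it contains `w` whenever it contains two
vectors whose projections to the orthogonal complement of `w` are orthogonal. -/
structure IsNonorthogonalFamily (𝕜 : Type u) {H : Type v} [RCLike 𝕜] [NormedAddCommGroup H]
    [InnerProductSpace 𝕜 H] (S : Set H) : Prop where
  inner_ne_zero : ∀ {x y : H}, x ∈ S → y ∈ S → ⟪x, y⟫_𝕜 ≠ 0
  mem_of_inner : ∀ {x y w : H}, x ∈ S → y ∈ S → w ≠ 0 →
    ((‖w‖ ^ 2 : ℝ) : 𝕜) * ⟪x, y⟫_𝕜 = ⟪x, w⟫_𝕜 * ⟪w, y⟫_𝕜 → w ∈ S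

namespace IsNonorthogonalFamily

variable {S : Set H} (hS : IsNonorthogonalFamily 𝕜 S)
include hS

theorem ne_zero {x : H} (hx : x ∈ S) : x ≠ 0 := by
  rintro rfl
  exact hS.inner_ne_zero hx hx (inner_zero_left _)

/-- Projecting `x` along its own multiple gives zero, which is orthogonal to itself. -/
theorem smul_mem {x : H} (hx : x ∈ S) {c : 𝕜} (hc : c ≠ 0) : c • x ∈ S := by
  refine hS.mem_of_inner hx hx (smul_ne_zero hc (hS.ne_zero hx)) ?_
  rw [inner_smul_left, inner_smul_right, norm_smul, inner_self_eq_norm_sq_to_K]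
  have h := RCLike.conj_mul c
  push_cast
  linear_combination (-(‖x‖ : 𝕜) ^ 4) * h

/-- If `x` and `x + y` belong to the family, then so does a circle of vectors spanned by the
orthogonal vectors `x`, `y`, `z`. -/
theorem circle_mem {x y z : H} (hxy : ⟪x, y⟫_𝕜 = 0) (hxz : ⟪x, z⟫_𝕜 = 0) (hyz : ⟪y, z⟫_𝕜 = 0)
    (hnorm : ‖z‖ = ‖y‖) (hx : x ∈ S) (hy : x + y ∈ S) {b c : ℝ} (hbc : b ^ 2 + c ^ 2 = b) :
    ((1 : ℝ) : 𝕜) • x + (b : 𝕜) • y + (c : 𝕜) • z ∈ S := by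
  have key := inner_real_combination hxy hxz hyz
  have ex : x = ((1 : ℝ) : 𝕜) • x + ((0 : ℝ) : 𝕜) • y + ((0 : ℝ) : 𝕜) • z := by simp
  have ey : x + y = ((1 : ℝ) : 𝕜) • x + ((1 : ℝ) : 𝕜) • y + ((0 : ℝ) : 𝕜) • z := by simp
  set w := ((1 : ℝ) : 𝕜) • x + (b : 𝕜) • y + (c : 𝕜) • z with hw
  have h1 : ⟪x, w⟫_𝕜 = ((‖x‖ ^ 2 : ℝ) : 𝕜) := by
    conv_lhs => rw [ex]
    rw [hw, key]
    congr 1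
    ring
  have h2 : ⟪w, x + y⟫_𝕜 = ((‖x‖ ^ 2 + b * ‖y‖ ^ 2 : ℝ) : 𝕜) := by
    rw [ey, hw, key]
    congr 1
    ring
  have h3 : ⟪x, x + y⟫_𝕜 = ((‖x‖ ^ 2 : ℝ) : 𝕜) := by
    rw [inner_add_right, hxy, add_zero, inner_self_eq_norm_sq_to_K]
    push_cast
    rfl
  -- `hbc` puts `w` on the Thales circle with diameter from `x` to `x + y`, so that `‖w‖ ^ 2 = ⟪w, x
  -- + y⟫`.
  have h4 : ‖w‖ ^ 2 = ‖x‖ ^ 2 + b * ‖y‖ ^ 2 := by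
    have h := key 1 b c 1 b c
    rw [← hw, inner_self_eq_norm_sq_to_K, ← RCLike.ofReal_pow] at h
    rw [RCLike.ofReal_injective h, hnorm]
    linear_combination ‖y‖ ^ 2 * hbc
  have hw0 : w ≠ 0 := by
    intro h
    rw [h, inner_zero_right] at h1
    have : ‖x‖ ^ 2 = 0 := by exact_mod_cast h1.symm
    exact hS.ne_zero hx (by simpa using this)
  refine hS.mem_of_inner hx hy hw0 ?_
  rw [h1, h2, h3, h4, mul_comm]

/-- Starting from two vectors `x` and `x + y` at an angle `θ` with `tan² θ = t`, one finds two
vectors at an angle `θ'` with `tan² θ' = t + t² / 4`; once `t ≥ 8` one finds an orthogonal pair. -/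
theorem false_of_tan_sq [FiniteDimensional 𝕜 H] (hdim : 3 ≤ Module.finrank 𝕜 H) {δ : ℝ} (n : ℕ) :
    ∀ {t : ℝ} {x y : H}, 0 < t → δ ≤ t ^ 2 / 4 → 8 ≤ t + n * δ → ⟪x, y⟫_𝕜 = 0 →
      ‖y‖ ^ 2 = t * ‖x‖ ^ 2 → x ∈ S → x + y ∈ S → False := by
  induction n with
  | zero =>
    intro t x y ht _ h8 hxy hT hx hy
    obtain ⟨z, hxz, hyz, hz⟩ := exists_orthogonal_pair_norm_eq hdim x y (norm_nonneg y)
    have h8' : 8 ≤ t := by simpa using h8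
    have hroot : 0 ≤ 1 - 8 / t := by
      rw [sub_nonneg, div_le_one ht]
      exact h8'
    have hsq := Real.sq_sqrt hroot
    set s := √(1 - 8 / t) with hs
    have hs0 : 0 ≤ s := Real.sqrt_nonneg _
    have hs1 : s ≤ 1 := by
      have : 0 < 8 / t := by positivity
      nlinarith
    -- The points with coordinates `(b, ±c)` are orthogonal iff `t * (2 * b ^ 2 - b) = -1`, and `b`
    -- is a root. The minimum `-1/8` of `2 * b ^ 2 - b` explains the threshold `8`.
    set b := (1 + s) / 4 with hb
    have hc : 0 ≤ b - b ^ 2 := by rw [hb]; nlinarith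
    have hcsq := Real.sq_sqrt hc
    have hw := hS.circle_mem hxy hxz hyz hz hx hy (b := b) (c := √(b - b ^ 2)) (by linarith)
    have hw' := hS.circle_mem hxy hxz hyz hz hx hy (b := b) (c := -√(b - b ^ 2))
      (by rw [neg_sq]; linarith)
    refine hS.inner_ne_zero hw hw' ?_
    rw [inner_real_combination hxy hxz hyz, hz, hT]
    norm_cast
    have hts : t * s ^ 2 = t - 8 := by
      rw [hsq]
      field_simp
    have : t * (b ^ 2 - √(b - b ^ 2) ^ 2) = -1 := by
      rw [hcsq, hb]
      linear_combination hts / 8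
    linear_combination ‖x‖ ^ 2 * this
  | succ n ih =>
    intro t x y ht hδ h8 hxy hT hx hy
    obtain ⟨z, hxz, hyz, hz⟩ := exists_orthogonal_pair_norm_eq hdim x y (norm_nonneg y)
    -- The ends of the diameter along `z` subtend an angle of cosine `1 / (1 + t / 2)`, hence of
    -- squared tangent `(1 + t / 2) ^ 2 - 1 = t + t ^ 2 / 4`.
    have hw := hS.circle_mem hxy hxz hyz hz hx hy (b := 1 / 2) (c := 1 / 2) (by norm_num)
    have hw' := hS.circle_mem hxy hxz hyz hz hx hy (b := 1 / 2) (c := -(1 / 2)) (by norm_num)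
    have key := inner_real_combination hxy hxz hyz
    have hnn := key 1 (1 / 2) (1 / 2) 1 (1 / 2) (1 / 2)
    have hnn' := key 1 (1 / 2) (-(1 / 2)) 1 (1 / 2) (-(1 / 2))
    have hin := key 1 (1 / 2) (1 / 2) 1 (1 / 2) (-(1 / 2))
    set w := ((1 : ℝ) : 𝕜) • x + ((1 / 2 : ℝ) : 𝕜) • y + ((1 / 2 : ℝ) : 𝕜) • z
    set w' := ((1 : ℝ) : 𝕜) • x + ((1 / 2 : ℝ) : 𝕜) • y + ((-(1 / 2) : ℝ) : 𝕜) • z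
    rw [inner_self_eq_norm_sq_to_K, ← RCLike.ofReal_pow] at hnn hnn'
    have hnw : ‖w‖ ^ 2 = (1 + t / 2) * ‖x‖ ^ 2 := by
      rw [RCLike.ofReal_injective hnn, hz, hT]; ring
    have hnw' : ‖w'‖ ^ 2 = (1 + t / 2) * ‖x‖ ^ 2 := by
      rw [RCLike.ofReal_injective hnn', hz, hT]; ring
    have hin' : ⟪w, w'⟫_𝕜 = ((‖x‖ ^ 2 : ℝ) : 𝕜) := by
      rw [hin, hz, hT]; congr 1; ring
    have horth : ⟪w, ((1 + t / 2 : ℝ) : 𝕜) • w' - w⟫_𝕜 = 0 := by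
      rw [inner_sub_right, inner_smul_right, hin', inner_self_eq_norm_sq_to_K,
        ← RCLike.ofReal_pow, hnw]
      push_cast
      ring
    have hc : ((1 + t / 2 : ℝ) : 𝕜) ≠ 0 := RCLike.ofReal_ne_zero.mpr (by positivity)
    refine ih (t := t + t ^ 2 / 4) (x := w) (y := ((1 + t / 2 : ℝ) : 𝕜) • w' - w)
      (by positivity) ?_ ?_ horth ?_ hw ?_
    -- The increment grows with `t`, so `δ` stays a lower bound for it.
    · refine hδ.trans ?_
      have : t ≤ t + t ^ 2 / 4 := by nlinarith [sq_nonneg t]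
      gcongr
    · push_cast at h8
      linarith
    · have hpyth := norm_add_sq_eq_norm_sq_add_norm_sq_of_inner_eq_zero w
        (((1 + t / 2 : ℝ) : 𝕜) • w' - w) horth
      rw [add_sub_cancel, norm_smul, RCLike.norm_ofReal, abs_of_pos (by positivity)] at hpyth
      nlinarith
    · rw [add_sub_cancel]
      exact hS.smul_mem hw' hc

/-- In dimension at least three, a nonorthogonal family spans at most one line. -/
theorem mem_span_singleton [FiniteDimensional 𝕜 H] (hdim : 3 ≤ Module.finrank 𝕜 H) {x y : H}
    (hx : x ∈ S) (hy : y ∈ S) : y ∈ Submodule.span 𝕜 {x} := by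
  have hxy := hS.inner_ne_zero hx hy
  have hx0 := hS.ne_zero hx
  have hxx : ⟪x, x⟫_𝕜 ≠ 0 := inner_self_ne_zero.mpr hx0
  -- This scaling makes `c • y` equal to `x` plus a vector orthogonal to `x`.
  set c : 𝕜 := ⟪x, x⟫_𝕜 / ⟪x, y⟫_𝕜 with hc
  have hc0 : c ≠ 0 := div_ne_zero hxx hxy
  have hcy := hS.smul_mem hy hc0
  have horth : ⟪x, c • y - x⟫_𝕜 = 0 := by
    rw [inner_sub_right, inner_smul_right, hc, div_mul_cancel₀ _ hxy, sub_self]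
  by_cases h0 : c • y - x = 0
  · rw [Submodule.mem_span_singleton]
    refine ⟨c⁻¹, ?_⟩
    rw [← sub_eq_zero.mp h0, inv_smul_smul₀ hc0]
  · exfalso
    have hpos : 0 < ‖x‖ ^ 2 := pow_pos (norm_pos_iff.mpr hx0) 2
    have hpos' : 0 < ‖c • y - x‖ ^ 2 := pow_pos (norm_pos_iff.mpr h0) 2
    set t : ℝ := ‖c • y - x‖ ^ 2 / ‖x‖ ^ 2 with ht
    have ht0 : 0 < t := div_pos hpos' hpos
    obtain ⟨n, hn⟩ := exists_nat_ge (8 / (t ^ 2 / 4))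
    rw [div_le_iff₀ (by positivity)] at hn
    refine hS.false_of_tan_sq hdim n ht0 le_rfl (by linarith) horth ?_ hx ?_
    · rw [ht, div_mul_cancel₀ _ hpos.ne']
    · rwa [add_sub_cancel]

end IsNonorthogonalFamily

end NonorthogonalFamilies

/-! ### From states to nonorthogonal families -/

namespace MeasurementLogic

variable {𝕜 : Type u} {H : Type v} [RCLike 𝕜] [NormedAddCommGroup H] [InnerProductSpace 𝕜 H]

/-- The line through a vector, as a closed subspace. -/
noncomputable def line (𝕜 : Type u) {H : Type v} [RCLike 𝕜] [NormedAddCommGroup H]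
    [InnerProductSpace 𝕜 H] (x : H) : ClosedSubmodule 𝕜 H :=
  ⟨Submodule.span 𝕜 {x}, Submodule.closed_of_finiteDimensional _⟩

theorem mem_line {x y : H} : y ∈ line 𝕜 x ↔ ∃ c : 𝕜, c • x = y :=
  Submodule.mem_span_singleton

variable [CompleteSpace H]

/-- The Sasaki projection `p & q` lies below every closed subspace that contains the orthogonal
projection of `p` to `q`. -/
theorem sasaki_le {p q r : ClosedSubmodule 𝕜 H} [q.toSubmodule.HasOrthogonalProjection]
    (h : ∀ x ∈ p, q.toSubmodule.starProjection x ∈ r) : sasaki p q ≤ r := by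
  -- The preimage of `r` is a closed subspace that contains `p` by hypothesis and `qᶜ` as the
  -- kernel; on `q` the projection is the identity.
  have hsup : p ⊔ qᶜ ≤ r.comap q.toSubmodule.starProjection := by
    refine sup_le h fun x hx => ?_
    have : q.toSubmodule.starProjection x = 0 :=
      q.toSubmodule.starProjection_apply_eq_zero_iff.mpr hx
    change q.toSubmodule.starProjection x ∈ r
    rw [this]
    exact r.toSubmodule.zero_mem
  rintro x ⟨hxq, hx⟩
  have hxr : q.toSubmodule.starProjection x ∈ r := hsup hx
  rwa [Submodule.starProjection_eq_self_iff.mpr hxq] at hxr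

variable {A : Type w} {M : A → ClosedSubmodule 𝕜 H → A → Prop}

theorem exists_mes_of_not_verifies_compl {a : A} {q : ClosedSubmodule 𝕜 H}
    (h : ¬ Verifies M a qᶜ) : ∃ b, M a q b := by
  rwa [Verifies, OrthomodularLattice.compl_compl', not_not] at h

/-- The vectors whose line is verified by a given state form a nonorthogonal family. -/
theorem IsModel.isNonorthogonalFamily (hM : IsModel M) (a : A) :
    IsNonorthogonalFamily 𝕜 {x : H | Verifies M a (line 𝕜 x)} := by
  obtain ⟨-, hbot, -, hup, hsas, hpres⟩ := (isModel_iff M).mp hM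
  have hA : ∀ (a : A) {x y : H}, Verifies M a (line 𝕜 x) → Verifies M a (line 𝕜 y) →
      ⟪x, y⟫_𝕜 ≠ 0 := by
    intro a x y hx hy hxy
    have hle : sasaki (line 𝕜 x) (line 𝕜 y) ≤ ⊥ := by
      have : (line 𝕜 y).toSubmodule.HasOrthogonalProjection :=
        inferInstanceAs (Submodule.span 𝕜 {y}).HasOrthogonalProjection
      refine sasaki_le fun z hz => ?_
      obtain ⟨c, rfl⟩ := mem_line.mp hz
      have : (line 𝕜 y).toSubmodule.starProjection (c • x) = 0 := by
        rw [Submodule.starProjection_apply_eq_zero_iff]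
        change c • x ∈ (Submodule.span 𝕜 {y})ᗮ
        rw [Submodule.mem_orthogonal_singleton_iff_inner_left, inner_smul_left, hxy, mul_zero]
      rw [this]
      exact zero_mem _
    exact hbot a (hup _ _ hle a (hsas _ _ a ⟨hx, hy⟩))
  refine ⟨hA a, fun {x y w} hx hy hw h => ?_⟩
  by_contra hmem
  have hmem' : ¬ Verifies M a (line 𝕜 w)ᶜᶜ := by
    rwa [OrthomodularLattice.compl_compl']
  obtain ⟨b, hb⟩ := exists_mes_of_not_verifies_compl hmem'
  have hproj : ∀ z : H, Verifies M a (line 𝕜 z) →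
      Verifies M b (line 𝕜 (z - (⟪w, z⟫_𝕜 / ((‖w‖ ^ 2 : ℝ) : 𝕜)) • w)) := by
    intro z hz
    refine hup _ _ ?_ b (hpres _ _ a b ⟨hz, hb⟩)
    have : ((line 𝕜 w)ᶜ).toSubmodule.HasOrthogonalProjection :=
      inferInstanceAs (Submodule.span 𝕜 {w})ᗮ.HasOrthogonalProjection
    refine sasaki_le fun z' hz' => ?_
    obtain ⟨c, rfl⟩ := mem_line.mp hz'
    rw [map_smul, mem_line]
    refine ⟨c, congrArg _ ?_⟩
    change _ = (Submodule.span 𝕜 {w})ᗮ.starProjection z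
    rw [Submodule.starProjection_orthogonal_val, Submodule.starProjection_singleton]
  refine hA b (hproj x hx) (hproj y hy) ?_
  have hw0 : ((‖w‖ : ℝ) : 𝕜) ≠ 0 := RCLike.ofReal_ne_zero.mpr (norm_ne_zero_iff.mpr hw)
  simp only [inner_sub_left, inner_sub_right, inner_smul_left, inner_smul_right, map_div₀,
    inner_conj_symm, RCLike.conj_ofReal, inner_self_eq_norm_sq_to_K]
  push_cast at h ⊢
  field_simp
  linear_combination h

/-- A vector of a minimal verified subspace that is orthogonal to some verified subspace is
zero. -/
theorem IsModel.eq_zero_of_minimal (hM : IsModel M) {a : A} {P R : ClosedSubmodule 𝕜 H}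
    (hP : Minimal (fun R => R ∈ verified M a) P) (hR : Verifies M a R) {x : H} (hx : x ∈ P)
    (hxR : ∀ y ∈ R, ⟪y, x⟫_𝕜 = 0) : x = 0 := by
  obtain ⟨-, -, -, -, hsas, -⟩ := (isModel_iff M).mp hM
  -- By minimality `P` lies in `R ⊔ Pᶜ`, and `x` is orthogonal to both terms, hence to itself.
  have hle : P ≤ sasaki R P := hP.2 (hsas R P a ⟨hR, hP.1⟩) inf_le_left
  have hsup : R ⊔ Pᶜ ≤ (line 𝕜 x).orthogonal := by
    refine sup_le (fun y hy => ?_) fun y hy => ?_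
    · change y ∈ (Submodule.span 𝕜 {x})ᗮ
      rw [Submodule.mem_orthogonal_singleton_iff_inner_left]
      exact hxR y hy
    · change y ∈ (Submodule.span 𝕜 {x})ᗮ
      rw [Submodule.mem_orthogonal_singleton_iff_inner_right]
      exact (Submodule.mem_orthogonal _ _).mp hy x hx
  have hmem : x ∈ (Submodule.span 𝕜 {x})ᗮ := hsup (hle hx).2
  rw [Submodule.mem_orthogonal_singleton_iff_inner_right] at hmem
  exact inner_self_eq_zero.mp hmem

end MeasurementLogic

/-! ### Uniqueness of the minimal verified subspace -/

open MeasurementLogic in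
theorem mainTheorem6 {𝕜 : Type u} {H : Type v} [RCLike 𝕜] [NormedAddCommGroup H]
    [InnerProductSpace 𝕜 H] [CompleteSpace H] [FiniteDimensional 𝕜 H]
    (hdim : 3 ≤ Module.finrank 𝕜 H)
    {A : Type w} (M : A → ClosedSubmodule 𝕜 H → A → Prop)
    (hM : MeasurementLogic.IsModel M) (a : A) :
    ∀ P Q : ClosedSubmodule 𝕜 H,
      Minimal (fun R => R ∈ MeasurementLogic.verified M a) P →
      Minimal (fun R => R ∈ MeasurementLogic.verified M a) Q → P = Q := by
  intro P Q hP hQ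
  by_contra hPQ
  obtain ⟨-, -, -, hup, -, hpres⟩ := (isModel_iff M).mp hM
  obtain ⟨x, hxP, hxZ, hx0⟩ : ∃ x ∈ P.toSubmodule,
      x ∈ (P.toSubmodule ⊓ Q.toSubmodule)ᗮ ∧ x ≠ 0 := by
    by_contra! hcon
    have hle : P.toSubmodule ≤ P.toSubmodule ⊓ Q.toSubmodule := by
      intro x hx
      have hz := (P.toSubmodule ⊓ Q.toSubmodule).starProjection_apply_mem x
      have h0 := hcon _ (sub_mem hx hz.1) (Submodule.sub_starProjection_mem_orthogonal x)
      rw [sub_eq_zero.mp h0]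
      exact hz
    have hPQle : P ≤ Q := fun x hx => (hle hx).2
    exact hPQ (le_antisymm hPQle (hQ.2 hP.1 hPQle))
  set y := Q.toSubmodule.starProjection x with hy
  have hyQ : y ∈ Q.toSubmodule := Q.toSubmodule.starProjection_apply_mem x
  have hxy : x - y ∈ Q.toSubmoduleᗮ := Q.toSubmodule.sub_starProjection_mem_orthogonal x
  have hy0 : y ≠ 0 := by
    intro h
    refine hx0 (hM.eq_zero_of_minimal hP hQ.1 hxP fun z hz => ?_)
    rw [h, sub_zero] at hxy
    exact (Submodule.mem_orthogonal _ _).mp hxy z hz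
  have hyx : ∀ z ∈ Q.toSubmodule, ⟪z, y⟫_𝕜 = ⟪z, x⟫_𝕜 := by
    intro z hz
    have := (Submodule.mem_orthogonal _ _).mp hxy z hz
    rw [inner_sub_right] at this
    exact (sub_eq_zero.mp this).symm
  set X := (Submodule.span 𝕜 {x})ᗮ with hX
  -- Projecting along `K` kills a hyperplane of `P` and one of `Q` but fixes `x`.
  set K := P.toSubmodule ⊓ X ⊔ Q.toSubmodule ⊓ X with hK
  have hKX : K ≤ X := sup_le inf_le_right inf_le_right
  have hxK : x ∈ Kᗮ := by
    rw [Submodule.mem_orthogonal]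
    intro z hz
    exact Submodule.mem_orthogonal_singleton_iff_inner_left.mp (hKX hz)
  let q : ClosedSubmodule 𝕜 H := ⟨Kᗮ, Submodule.isClosed_orthogonal K⟩
  have hkill : ∀ z ∈ K, q.toSubmodule.starProjection z = 0 := by
    intro z hz
    rw [Submodule.starProjection_apply_eq_zero_iff]
    exact Submodule.le_orthogonal_orthogonal K hz
  have hfix : q.toSubmodule.starProjection x = x := Submodule.starProjection_eq_self_iff.mpr hxK
  -- `qᶜ` is `K`, which is orthogonal to the nonzero vector `x` of the minimal `P`.
  have hnot : ¬ Verifies M a qᶜ := by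
    intro h
    refine hx0 (hM.eq_zero_of_minimal hP h hxP fun z hz => ?_)
    exact Submodule.inner_left_of_mem_orthogonal hxK hz
  obtain ⟨b, hb⟩ := exists_mes_of_not_verifies_compl hnot
  have hxb : Verifies M b (line 𝕜 x) := by
    refine hup _ _ (sasaki_le fun z hz => ?_) b (hpres _ _ a b ⟨hP.1, hb⟩)
    have hmem : z - (⟪x, z⟫_𝕜 / ⟪x, x⟫_𝕜) • x ∈ K := by
      refine (le_sup_left : _ ≤ K) ⟨sub_mem hz (Submodule.smul_mem _ _ hxP), ?_⟩
      rw [SetLike.mem_coe, hX, Submodule.mem_orthogonal_singleton_iff_inner_right,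
        inner_sub_right, inner_smul_right,
        div_mul_cancel₀ _ (inner_self_ne_zero.mpr hx0), sub_self]
    have h0 := hkill _ hmem
    rw [map_sub, map_smul, hfix, sub_eq_zero] at h0
    exact mem_line.mpr ⟨_, h0.symm⟩
  have hyb : Verifies M b (line 𝕜 (q.toSubmodule.starProjection y)) := by
    refine hup _ _ (sasaki_le fun z hz => ?_) b (hpres _ _ a b ⟨hQ.1, hb⟩)
    have hxy' : ⟪x, y⟫_𝕜 = ⟪y, y⟫_𝕜 := by
      rw [← inner_conj_symm, ← hyx y hyQ, inner_conj_symm]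
    -- On `Q` the functionals given by `x` and `y` agree, so `Q` is spanned by `y` and `Q ⊓ X`.
    have hmem : z - (⟪x, z⟫_𝕜 / ⟪y, y⟫_𝕜) • y ∈ K := by
      refine (le_sup_right : _ ≤ K) ⟨sub_mem hz (Submodule.smul_mem _ _ hyQ), ?_⟩
      rw [SetLike.mem_coe, hX, Submodule.mem_orthogonal_singleton_iff_inner_right,
        inner_sub_right, inner_smul_right,
        hxy', div_mul_cancel₀ _ (inner_self_ne_zero.mpr hy0), sub_self]
    have h0 := hkill _ hmem
    rw [map_sub, map_smul, sub_eq_zero] at h0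
    exact mem_line.mpr ⟨_, h0.symm⟩
  obtain ⟨c, hc⟩ := Submodule.mem_span_singleton.mp
    ((hM.isNonorthogonalFamily b).mem_span_singleton hdim hxb hyb)
  have hyK : y - c • x ∈ K := by
    have h : q.toSubmodule.starProjection (y - c • x) = 0 := by
      rw [map_sub, map_smul, hfix, hc, sub_self]
    rw [Submodule.starProjection_apply_eq_zero_iff] at h
    rwa [← Submodule.orthogonal_orthogonal K]
  obtain ⟨p, hp, r, hr, hpr⟩ := Submodule.mem_sup.mp hyK
  -- The same vector is `y - r` in `Q` and `p + c • x` in `P`. It is orthogonal to `x` by `hxZ`, and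
  -- so is `r`; this forces `⟪y, y⟫ = ⟪y, x⟫ = 0`.
  have hyr : y - r ∈ P.toSubmodule ⊓ Q.toSubmodule := by
    refine ⟨?_, sub_mem hyQ hr.1⟩
    have : y - r = p + c • x := by
      rw [sub_eq_iff_eq_add, add_right_comm, hpr, sub_add_cancel]
    rw [this]
    exact add_mem hp.1 (Submodule.smul_mem _ _ hxP)
  have h1 : ⟪y - r, x⟫_𝕜 = 0 := (Submodule.mem_orthogonal _ _).mp hxZ _ hyr
  have h2 : ⟪r, x⟫_𝕜 = 0 := Submodule.mem_orthogonal_singleton_iff_inner_left.mp hr.2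
  rw [inner_sub_left, h2, sub_zero, ← hyx y hyQ] at h1
  exact hy0 (inner_self_eq_zero.mp h1)
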